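/- Let $(X_i)_{i=-\infty}^{\infty}$ be a stationary process over a finite alphabet $\mathbb{X}$ on a probability space $(\Omega,\mathcal{F},P)$. Write $X_1^k=(X_1,\dots,X_k)$, let $H(p)=-\sum_{w:p(w)>0}p(w)\log_2 p(w)$ be the entropy of a distribution $p$ on a finite set, let $H(k)$ be the entropy of the distribution of $X_1^k$, and let $\mathcal{I}$ be the shift-invariant $\sigma$-algebra of the process, i.e. the family of events $\{(X_i)_{i\in\mathbb{Z}}\in B\}$ with $B\subseteq\mathbb{X}^{\mathbb{Z}}$ measurable and shift-invariant. Let $H(X_1^k|\mathcal{I})=\mathbf{E}\,H\bigl(P(X_1^k=\cdot\,|\mathcal{I})\bigr)$ be the conditional entropy of $X_1^k$ given $\mathcal{I}$. Then the entropy rate $h=\lim_{k\to\infty}H(k)/k$ exists and $$\lim_{k\to\infty}\frac{H(X_1^k|\mathcal{I})}{k}=h.$$ That is, the entropy rate equals the average entropy rate of the ergodic components: if $P_\omega$ denotes the regular conditional distribution of $(X_i)_{i\in\mathbb{Z}}$ on $\mathbb{X}^{\mathbb{Z}}$ given $\mathcal{I}$, then for almost every $\omega$ the entropy rate $r(\omega)$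 of the coordinate process under $P_\omega$ exists, $r$ is integrable, and $\int r\,dP=h$. -/

import Mathlib

open MeasureTheory ProbabilityTheory Filter Topology

namespace StationaryProcess

/-- The sequence space `A^ℤ` as the target of the path map of a two-sided process. -/
def path {Ω A : Type*} (X : ℤ → Ω → A) : Ω → (ℤ → A) := fun ω i => X i ω

/-- The left shift on two-sided sequences. -/
def shift {A : Type*} : (ℤ → A) → (ℤ → A) := fun x i => x (i + 1)

/-- A process is (strictly) stationary if its law on `A^ℤ` is invariant under the shift. -/
def IsStationaryProcess {Ω A : Type*} [MeasurableSpace Ω] [MeasurableSpace A]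
    (X : ℤ → Ω → A) (μ : Measure Ω) : Prop :=
  (μ.map (path X)).map shift = μ.map (path X)

/-- The block `X_1^k = (X_1, …, X_k)`. -/
def block {Ω A : Type*} (X : ℤ → Ω → A) (k : ℕ) : Ω → (Fin k → A) :=
  fun ω i => X ((i : ℤ) + 1) ω

/-- Entropy, in bits, of a distribution on a finite set (with `0 log 0 = 0`, which holds here
since `Real.logb 2 0 = 0`). -/
noncomputable def entropy {B : Type*} [Fintype B] (p : B → ℝ) : ℝ :=
  -∑ w, p w * Real.logb 2 (p w)

/-- The block entropy `H(k) = H(X_1^k)`. -/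
noncomputable def blockEntropy {Ω A : Type*} [MeasurableSpace Ω] [Fintype A]
    (X : ℤ → Ω → A) (μ : Measure Ω) (k : ℕ) : ℝ :=
  entropy fun w : Fin k → A => μ.real (block X k ⁻¹' {w})

/-- The entropy rate `lim H(k) / k` of the process exists and equals `h`. -/
def HasEntropyRate {Ω A : Type*} [MeasurableSpace Ω] [Fintype A]
    (X : ℤ → Ω → A) (μ : Measure Ω) (h : ℝ) : Prop :=
  Tendsto (fun k : ℕ => blockEntropy X μ k / k) atTop (𝓝 h)

/-- The shift-invariant σ-algebra of the process: the events `{(X_i)_i ∈ B}` with `B ⊆ A^ℤ`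
measurable and shift-invariant. -/
@[reducible]
def invariantAlgebra {Ω A : Type*} [MeasurableSpace A] (X : ℤ → Ω → A) : MeasurableSpace Ω :=
  (MeasurableSpace.invariants (shift (A := A))).comap (path X)

theorem measurable_path {Ω A : Type*} [MeasurableSpace Ω] [MeasurableSpace A]
    {X : ℤ → Ω → A} (hX : ∀ i, Measurable (X i)) : Measurable (path X) :=
  measurable_pi_lambda _ hX

theorem invariantAlgebra_le {Ω A : Type*} [mΩ : MeasurableSpace Ω] [MeasurableSpace A]
    {X : ℤ → Ω → A} (hX : ∀ i, Measurable (X i)) : invariantAlgebra X ≤ mΩ :=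
  (MeasurableSpace.comap_mono (MeasurableSpace.invariants_le _)).trans
    (measurable_path hX).comap_le

/-- The conditional entropy `H(X_1^k | m)` given a σ-algebra `m`: the expected entropy of the
conditional distribution `w ↦ P(X_1^k = w | m)`. -/
noncomputable def condBlockEntropy {Ω A : Type*} [MeasurableSpace Ω] [Fintype A]
    (X : ℤ → Ω → A) (μ : Measure Ω) (m : MeasurableSpace Ω) (k : ℕ) : ℝ :=
  ∫ ω, entropy (fun w : Fin k → A => (μ⟦block X k ⁻¹' {w} | m⟧) ω) ∂μ

/-- The ergodic component of the process at `ω`: the value at `ω` of the regular conditional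
distribution of `(X_i)_i` on `A^ℤ` given the shift-invariant σ-algebra. -/
noncomputable def ergodicComponent {Ω A : Type*} [MeasurableSpace Ω] [MeasurableSpace A]
    [Nonempty A] [StandardBorelSpace A] (X : ℤ → Ω → A) (μ : Measure Ω) [IsFiniteMeasure μ]
    (ω : Ω) : Measure (ℤ → A) :=
  @condDistrib Ω Ω (ℤ → A) _ _ _ _ (invariantAlgebra X) (path X) id μ _ ω

/-- The coordinate process on `A^ℤ`. -/
def coord {A : Type*} : ℤ → (ℤ → A) → A := fun i x => x i

end StationaryProcess

namespace StationaryProcess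

/-! Write h for the entropy rate, which exists by stationarity, subadditivity of H and Fekete's
lemma. Jensen's inequality gives H(X_1^k|I) ≤ H(k) (`condBlockEntropy_le`). Everything else rests on
the bound h ≤ H(X_1^k|I)/k for each k ≥ 1 (`lim_le_condBlockEntropy_div`).

For that bound, fix k and cut Ω into finitely many invariant cells on which the conditional law of
X_1^k is almost constant (`exists_finite_partition_entropy_le`). Conditioning on an invariant cell
keeps the process stationary, so its block entropy at length mk is at most m times that at length k.
Knowing the cell costs at most the entropy K of the partition, which does not depend on m
(`entropy_mixture_le`). Hence H(mk) ≤ K + m(H(X_1^k|I) + ε); divide by m and let m grow.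

For the pathwise form, almost every component is stationary and so has a rate. H(X_1^k|I) is the
mean block entropy of the components, and dominated convergence exchanges limit and integral. Only
stationarity of the components is needed, not ergodicity. -/

/-! ### Entropy of finite distributions. -/

theorem entropy_eq_sum_negMulLog {B : Type*} [Fintype B] (p : B → ℝ) :
    entropy p = (∑ w, Real.negMulLog (p w)) / Real.log 2 := by
  simp only [entropy, Real.negMulLog, Real.logb, Finset.sum_div, ← Finset.sum_neg_distrib]
  exact Finset.sum_congr rfl fun w _ => by ring

theorem log_two_pos : (0 : ℝ) < Real.log 2 := Real.log_pos one_lt_two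

theorem entropy_nonneg {B : Type*} [Fintype B] {p : B → ℝ} (h0 : ∀ w, 0 ≤ p w)
    (h1 : ∀ w, p w ≤ 1) : 0 ≤ entropy p := by
  rw [entropy_eq_sum_negMulLog]
  exact div_nonneg (Finset.sum_nonneg fun w _ => Real.negMulLog_nonneg (h0 w) (h1 w))
    log_two_pos.le

theorem negMulLog_le_one {x : ℝ} (h0 : 0 ≤ x) : Real.negMulLog x ≤ 1 := by
  rcases h0.eq_or_lt with rfl | hx
  · simp
  · have h := Real.one_sub_inv_le_log_of_pos hx
    have h' := mul_le_mul_of_nonneg_left h h0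
    rw [mul_sub, mul_inv_cancel₀ hx.ne'] at h'
    simp only [Real.negMulLog]
    linarith

theorem entropy_le_card {B : Type*} [Fintype B] {p : B → ℝ} (h0 : ∀ w, 0 ≤ p w) :
    entropy p ≤ Fintype.card B / Real.log 2 := by
  rw [entropy_eq_sum_negMulLog]
  refine div_le_div_of_nonneg_right ?_ log_two_pos.le
  calc ∑ w, Real.negMulLog (p w) ≤ ∑ _w : B, (1 : ℝ) :=
        Finset.sum_le_sum fun w _ => negMulLog_le_one (h0 w)
    _ = Fintype.card B := by simp

theorem continuous_entropy {B : Type*} [Fintype B] :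
    Continuous (entropy : (B → ℝ) → ℝ) := by
  have : (entropy : (B → ℝ) → ℝ) = fun p => (∑ w, Real.negMulLog (p w)) / Real.log 2 :=
    funext entropy_eq_sum_negMulLog
  rw [this]
  fun_prop

theorem entropy_comp_equiv {B C : Type*} [Fintype B] [Fintype C] (e : B ≃ C) (p : C → ℝ) :
    entropy (fun b => p (e b)) = entropy p := by
  simp only [entropy]
  rw [Equiv.sum_comp e fun c => p c * Real.logb 2 (p c)]

/-- Subadditivity of entropy: a joint entropy is at most the sum of the marginal entropies. -/
theorem entropy_prod_le {B C : Type*} [Fintype B] [Fintype C] {p : B × C → ℝ} {q : B → ℝ}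
    {r : C → ℝ} (h0 : ∀ w, 0 ≤ p w) (h1 : ∑ w, p w = 1) (hq : ∀ b, ∑ c, p (b, c) = q b)
    (hr : ∀ c, ∑ b, p (b, c) = r c) : entropy p ≤ entropy q + entropy r := by
  have q0 : ∀ b, 0 ≤ q b := fun b => hq b ▸ Finset.sum_nonneg fun c _ => h0 _
  have r0 : ∀ c, 0 ≤ r c := fun c => hr c ▸ Finset.sum_nonneg fun b _ => h0 _
  have hpq : ∀ b c, p (b, c) ≤ q b := fun b c =>
    hq b ▸ Finset.single_le_sum (f := fun c => p (b, c)) (fun c _ => h0 _) (Finset.mem_univ c)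
  have hpr : ∀ b c, p (b, c) ≤ r c := fun b c =>
    hr c ▸ Finset.single_le_sum (f := fun b => p (b, c)) (fun b _ => h0 _) (Finset.mem_univ b)
  have hq1 : ∑ b, q b = 1 := by
    rw [← h1, Fintype.sum_prod_type]
    exact Finset.sum_congr rfl fun b _ => (hq b).symm
  have hr1 : ∑ c, r c = 1 := by
    rw [← h1, Fintype.sum_prod_type_right]
    exact Finset.sum_congr rfl fun c _ => (hr c).symm
  -- This is log t ≤ t - 1 at t = q r / p, multiplied by p. Summed over all pairs, the right side
  -- vanishes: relative entropy is nonnegative.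
  have key : ∀ b c, Real.negMulLog (p (b, c)) + p (b, c) * Real.log (q b)
      + p (b, c) * Real.log (r c) ≤ q b * r c - p (b, c) := by
    intro b c
    rcases (h0 (b, c)).eq_or_lt with h | h
    · rw [← h]; simpa using mul_nonneg (q0 b) (r0 c)
    · have hqb := h.trans_le (hpq b c)
      have hrc := h.trans_le (hpr b c)
      have hl := Real.log_le_sub_one_of_pos (div_pos (mul_pos hqb hrc) h)
      rw [Real.log_div (mul_pos hqb hrc).ne' h.ne', Real.log_mul hqb.ne' hrc.ne'] at hl
      have hm := mul_le_mul_of_nonneg_left hl h.le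
      have hc : p (b, c) * (q b * r c / p (b, c)) = q b * r c := mul_div_cancel₀ _ h.ne'
      simp only [Real.negMulLog]
      rw [mul_sub _ _ (1 : ℝ), hc] at hm
      linarith
  have hsum := Finset.sum_le_sum fun b (_ : b ∈ Finset.univ) =>
    Finset.sum_le_sum fun c (_ : c ∈ Finset.univ) => key b c
  have e1 : ∑ b, ∑ c, p (b, c) * Real.log (q b) = -∑ b, Real.negMulLog (q b) := by
    rw [← Finset.sum_neg_distrib]
    refine Finset.sum_congr rfl fun b _ => ?_
    rw [← Finset.sum_mul, hq, Real.negMulLog]; ring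
  have e2 : ∑ b, ∑ c, p (b, c) * Real.log (r c) = -∑ c, Real.negMulLog (r c) := by
    rw [Finset.sum_comm, ← Finset.sum_neg_distrib]
    refine Finset.sum_congr rfl fun c _ => ?_
    rw [← Finset.sum_mul, hr, Real.negMulLog]; ring
  have e3 : ∑ b, ∑ c, (q b * r c - p (b, c)) = 0 := by
    simp only [Finset.sum_sub_distrib, ← Finset.mul_sum, hr1, mul_one, hq1]
    rw [← Fintype.sum_prod_type, h1, sub_self]
  simp only [Finset.sum_add_distrib] at hsum
  rw [e1, e2, e3] at hsum
  simp only [entropy_eq_sum_negMulLog, ← add_div]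
  refine div_le_div_of_nonneg_right ?_ log_two_pos.le
  rw [Fintype.sum_prod_type]
  linarith

/-- The entropy of a mixture is at most the entropy of the weights plus the mean entropy of the
components. -/
theorem entropy_mixture_le {J B : Type*} [Fintype J] [Fintype B] {l : J → ℝ} {p : J → B → ℝ}
    (hl : ∀ j, 0 ≤ l j) (hp : ∀ j w, 0 ≤ p j w) (hp1 : ∀ j, l j ≠ 0 → ∑ w, p j w = 1) :
    entropy (fun w => ∑ j, l j * p j w) ≤ entropy l + ∑ j, l j * entropy (p j) := by
  -- The mixture dominates each summand l j * p j w, so monotonicity of log bounds its entropy by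
  -- that of the joint law of (j, w), which splits by the chain rule.
  have key : ∀ w j, -(l j * p j w * Real.log (∑ i, l i * p i w)) ≤
      p j w * Real.negMulLog (l j) + l j * Real.negMulLog (p j w) := by
    intro w j
    rw [← add_comm, ← Real.negMulLog_mul, mul_comm (p j w), Real.negMulLog]
    rcases (mul_nonneg (hl j) (hp j w)).eq_or_lt with h | h
    · simp [← h]
    · have hle := Real.log_le_log h
        (Finset.single_le_sum (f := fun i => l i * p i w)
          (fun i _ => mul_nonneg (hl i) (hp i w)) (Finset.mem_univ j))
      have := mul_le_mul_of_nonneg_left hle h.le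
      linarith
  have hsum := Finset.sum_le_sum fun w (_ : w ∈ Finset.univ) =>
    Finset.sum_le_sum fun j (_ : j ∈ Finset.univ) => key w j
  have e1 : ∑ w, ∑ j, -(l j * p j w * Real.log (∑ i, l i * p i w)) =
      ∑ w, Real.negMulLog (∑ j, l j * p j w) := by
    refine Finset.sum_congr rfl fun w _ => ?_
    rw [Finset.sum_neg_distrib, ← Finset.sum_mul, Real.negMulLog, neg_mul]
  have e2 : ∑ w, ∑ j, p j w * Real.negMulLog (l j) = ∑ j, Real.negMulLog (l j) := by
    rw [Finset.sum_comm]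
    refine Finset.sum_congr rfl fun j _ => ?_
    rw [← Finset.sum_mul]
    by_cases h : l j = 0
    · simp [h]
    · rw [hp1 j h, one_mul]
  have e3 : ∑ w, ∑ j, l j * Real.negMulLog (p j w) = ∑ j, l j * ∑ w, Real.negMulLog (p j w) := by
    rw [Finset.sum_comm]
    exact Finset.sum_congr rfl fun j _ => (Finset.mul_sum _ _ _).symm
  simp only [Finset.sum_add_distrib] at hsum
  rw [e1, e2, e3] at hsum
  simp only [entropy_eq_sum_negMulLog, ← mul_div_assoc]
  rw [← Finset.sum_div, ← add_div]
  exact div_le_div_of_nonneg_right hsum log_two_pos.le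

/-! ### Block entropies of stationary processes. -/

theorem iterate_shift_apply {A : Type*} (n : ℕ) (x : ℤ → A) (i : ℤ) :
    (shift^[n] x) i = x (i + n) := by
  induction n generalizing x with
  | zero => simp
  | succ n ih =>
    rw [Function.iterate_succ_apply, ih, shift]
    congr 1
    push_cast
    ring

theorem blockEntropy_nonneg {Ω A : Type*} [MeasurableSpace Ω] [Fintype A]
    {X : ℤ → Ω → A} {μ : Measure Ω} [IsProbabilityMeasure μ] (k : ℕ) :
    0 ≤ blockEntropy X μ k :=
  entropy_nonneg (fun _ => measureReal_nonneg) fun _ => measureReal_le_one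

theorem bddBelow_blockEntropy_div {Ω A : Type*} [MeasurableSpace Ω] [Fintype A]
    {X : ℤ → Ω → A} {μ : Measure Ω} [IsProbabilityMeasure μ] :
    BddBelow (Set.range fun k : ℕ => blockEntropy X μ k / k) :=
  ⟨0, by rintro _ ⟨k, rfl⟩; exact div_nonneg (blockEntropy_nonneg k) k.cast_nonneg⟩

theorem blockEntropy_zero {Ω A : Type*} [MeasurableSpace Ω] [Fintype A]
    {X : ℤ → Ω → A} {μ : Measure Ω} [IsProbabilityMeasure μ] :
    blockEntropy X μ 0 = 0 := by
  have : ∀ w : Fin 0 → A, block X 0 ⁻¹' {w} = Set.univ := fun w =>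
    Set.eq_univ_of_forall fun _ => Subsingleton.elim _ _
  simp [blockEntropy, entropy, this]

section process

variable {Ω A : Type*} [MeasurableSpace Ω] [MeasurableSpace A]

theorem measurable_shift : Measurable (shift (A := A)) :=
  measurable_pi_lambda _ fun i => measurable_pi_apply (i + 1)

theorem measurable_block {X : ℤ → Ω → A} (hX : ∀ i, Measurable (X i)) (k : ℕ) :
    Measurable (block X k) :=
  measurable_pi_lambda _ fun _ => hX _

theorem measurable_coord (i : ℤ) : Measurable (coord (A := A) i) := measurable_pi_apply i

theorem IsStationaryProcess.measurePreserving {X : ℤ → Ω → A} {μ : Measure Ω}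
    (h : IsStationaryProcess X μ) : MeasurePreserving shift (μ.map (path X)) (μ.map (path X)) :=
  ⟨measurable_shift, h⟩

/-- Blocks of a stationary process have the same distribution wherever they start. -/
theorem IsStationaryProcess.measureReal_block_add [MeasurableSingletonClass A] {X : ℤ → Ω → A}
    {μ : Measure Ω} (h : IsStationaryProcess X μ) (hX : ∀ i, Measurable (X i)) (n k : ℕ)
    (w : Fin k → A) :
    μ.real {ω | (fun i : Fin k => X ((i : ℤ) + 1 + n) ω) = w} = μ.real (block X k ⁻¹' {w}) := by
  have hs : MeasurableSet (block (coord (A := A)) k ⁻¹' {w}) :=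
    measurable_block measurable_coord k (measurableSet_singleton w)
  have := (h.measurePreserving.iterate n).measure_preimage hs.nullMeasurableSet
  rw [Measure.map_apply (measurable_path hX) hs,
    Measure.map_apply (measurable_path hX) (measurable_shift.iterate n hs)] at this
  rw [measureReal_def, measureReal_def]
  congr 1
  refine Eq.trans (congrArg μ ?_) this
  ext ω
  have : block coord k (shift^[n] (path X ω)) = fun i : Fin k => X ((i : ℤ) + 1 + n) ω :=
    funext fun i => iterate_shift_apply n _ _
  simp only [Set.mem_ofPred_eq, Set.mem_preimage, Set.mem_singleton_iff, this]

variable [Fintype A] [MeasurableSingletonClass A]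

theorem sum_measureReal_preimage {B : Type*} [Fintype B] [MeasurableSpace B]
    [MeasurableSingletonClass B] {μ : Measure Ω} [IsFiniteMeasure μ] {f : Ω → B}
    (hf : Measurable f) (s : Set Ω) : ∑ w, μ.real (s ∩ f ⁻¹' {w}) = μ.real s := by
  have := sum_measureReal_preimage_singleton (μ := μ.restrict s) (f := f) Finset.univ
    (fun y _ => hf (measurableSet_singleton y))
  simp only [Finset.coe_univ, Set.preimage_univ, measureReal_restrict_apply_univ] at this
  rw [← this]
  refine Finset.sum_congr rfl fun w _ => ?_
  rw [measureReal_restrict_apply (hf (measurableSet_singleton w)), Set.inter_comm]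

theorem sum_measureReal_block {X : ℤ → Ω → A} {μ : Measure Ω} [IsProbabilityMeasure μ]
    (hX : ∀ i, Measurable (X i)) (k : ℕ) : ∑ w, μ.real (block X k ⁻¹' {w}) = 1 := by
  simpa using sum_measureReal_preimage (μ := μ) (measurable_block hX k) Set.univ

/-- Cut the block of length k + l after k letters. By stationarity the second piece has the law of
X_1^l, so `entropy_prod_le` applies. -/
theorem IsStationaryProcess.subadditive_blockEntropy {X : ℤ → Ω → A} {μ : Measure Ω}
    [IsProbabilityMeasure μ] (h : IsStationaryProcess X μ) (hX : ∀ i, Measurable (X i)) :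
    Subadditive (blockEntropy X μ) := by
  intro k l
  have happ : ∀ (b : Fin k → A) (c : Fin l → A),
      block X (k + l) ⁻¹' {Fin.append b c} =
        block X k ⁻¹' {b} ∩ {ω | (fun i : Fin l => X ((i : ℤ) + 1 + k) ω) = c} := by
    intro b c
    ext ω
    simp only [Set.mem_preimage, Set.mem_singleton_iff, Set.mem_inter_iff, Set.mem_ofPred_eq,
      funext_iff, block, Fin.forall_fin_add, Fin.append_left, Fin.append_right, Fin.val_castAdd,
      Fin.val_natAdd]
    refine and_congr Iff.rfl (forall_congr' fun i => ?_)
    have : (((k + i : ℕ) : ℤ) + 1) = (i : ℤ) + 1 + k := by push_cast; ring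
    rw [this]
  have hm2 : Measurable fun ω => fun i : Fin l => X ((i : ℤ) + 1 + k) ω :=
    measurable_pi_lambda _ fun _ => hX _
  rw [blockEntropy, ← entropy_comp_equiv (Fin.appendEquiv k l)]
  refine entropy_prod_le (fun _ => measureReal_nonneg) ?_ ?_ ?_
  · rw [Equiv.sum_comp (Fin.appendEquiv k l) fun w => μ.real (block X (k + l) ⁻¹' {w})]
    exact sum_measureReal_block hX _
  · intro b
    simp only [Fin.appendEquiv, Equiv.coe_fn_mk, happ]
    exact sum_measureReal_preimage hm2 _
  · intro c
    simp only [Fin.appendEquiv, Equiv.coe_fn_mk, happ]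
    rw [← h.measureReal_block_add hX k l c]
    simp only [Set.inter_comm (block X k ⁻¹' _)]
    exact sum_measureReal_preimage (measurable_block hX k) _

theorem IsStationaryProcess.hasEntropyRate {X : ℤ → Ω → A} {μ : Measure Ω}
    [IsProbabilityMeasure μ] (h : IsStationaryProcess X μ) (hX : ∀ i, Measurable (X i)) :
    HasEntropyRate X μ (h.subadditive_blockEntropy hX).lim :=
  (h.subadditive_blockEntropy hX).tendsto_lim bddBelow_blockEntropy_div

theorem IsStationaryProcess.blockEntropy_mul_le {X : ℤ → Ω → A} {μ : Measure Ω}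
    [IsProbabilityMeasure μ] (h : IsStationaryProcess X μ) (hX : ∀ i, Measurable (X i))
    (m k : ℕ) : blockEntropy X μ (m * k) ≤ m * blockEntropy X μ k := by
  simpa [blockEntropy_zero] using (h.subadditive_blockEntropy hX).apply_mul_add_le m k 0

/-- The bound depends only on the alphabet, so it can dominate the block entropies of all components
at once. -/
theorem IsStationaryProcess.blockEntropy_div_le {X : ℤ → Ω → A} {μ : Measure Ω}
    [IsProbabilityMeasure μ] (h : IsStationaryProcess X μ) (hX : ∀ i, Measurable (X i))
    (k : ℕ) : blockEntropy X μ k / k ≤ Fintype.card (Fin 1 → A) / Real.log 2 := by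
  have h1 : blockEntropy X μ 1 ≤ Fintype.card (Fin 1 → A) / Real.log 2 :=
    entropy_le_card fun _ => measureReal_nonneg
  have hk := h.blockEntropy_mul_le hX k 1
  rw [mul_one] at hk
  refine div_le_of_le_mul₀ k.cast_nonneg (by positivity [log_two_pos]) (hk.trans ?_)
  rw [mul_comm]
  exact mul_le_mul_of_nonneg_right h1 k.cast_nonneg

end process

/-! ### Invariant events and ergodic components. -/

/-- Shifting the process changes no probability relative to a shift-invariant event. -/
theorem IsStationaryProcess.measure_inter_shift {Ω A : Type*} [MeasurableSpace Ω]
    [MeasurableSpace A] {μ : Measure Ω}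
    {X : ℤ → Ω → A} (h : IsStationaryProcess X μ)
    (hX : ∀ i, Measurable (X i)) {F : Set Ω} (hF : MeasurableSet[invariantAlgebra X] F)
    {s : Set (ℤ → A)} (hs : MeasurableSet s) :
    μ (F ∩ path X ⁻¹' (shift ⁻¹' s)) = μ (F ∩ path X ⁻¹' s) := by
  obtain ⟨G, ⟨hG, hGi⟩, rfl⟩ := hF
  have := h.measurePreserving.measure_preimage (hG.inter hs).nullMeasurableSet
  rwa [Set.preimage_inter, hGi, Measure.map_apply (measurable_path hX) (hG.inter hs),
    Measure.map_apply (measurable_path hX) (hG.inter (measurable_shift hs))] at this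

theorem IsStationaryProcess.cond {Ω A : Type*} [MeasurableSpace Ω] [MeasurableSpace A] {μ : Measure Ω}
    {X : ℤ → Ω → A} (h : IsStationaryProcess X μ)
    (hX : ∀ i, Measurable (X i)) {F : Set Ω} (hF : MeasurableSet[invariantAlgebra X] F) :
    IsStationaryProcess X μ[|F] := by
  have hF' := invariantAlgebra_le hX _ hF
  ext s hs
  rw [Measure.map_apply measurable_shift hs,
    Measure.map_apply (measurable_path hX) (measurable_shift hs),
    Measure.map_apply (measurable_path hX) hs, cond_apply hF', cond_apply hF',
    h.measure_inter_shift hX hF hs]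

/-- If applying `f` to `Y` does not change its joint law with `Z`, then almost surely the
conditional distribution of `Y` given `Z` is invariant under `f`. -/
theorem ae_map_condDistrib_eq {Ω β E : Type*} [MeasurableSpace Ω] {mβ : MeasurableSpace β}
    [MeasurableSpace E] [StandardBorelSpace E] [Nonempty E] {μ : Measure Ω} [IsFiniteMeasure μ]
    {Z : Ω → β} {Y : Ω → E} {f : E → E} (hZ : Measurable Z) (hY : Measurable Y)
    (hf : Measurable f)
    (h : ∀ F s, MeasurableSet F → MeasurableSet s →
      μ (Z ⁻¹' F ∩ Y ⁻¹' (f ⁻¹' s)) = μ (Z ⁻¹' F ∩ Y ⁻¹' s)) :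
    ∀ᵐ ω ∂μ, (condDistrib Y Z μ (Z ω)).map f = condDistrib Y Z μ (Z ω) := by
  have hjoint : μ.map (fun ω => (Z ω, Y ω)) = μ.map fun ω => (Z ω, (f ∘ Y) ω) := by
    refine Measure.ext_prod fun {F s} hF hs => ?_
    rw [Measure.map_apply (by fun_prop) (hF.prod hs), Measure.map_apply (by fun_prop) (hF.prod hs)]
    exact (h F s hF hs).symm
  have h1 := condDistrib_comp (mβ := mβ) Z hY.aemeasurable hf (μ := μ)
  -- `condDistrib` is built from the joint law alone, so equal joint laws give the same kernel, not
  -- merely almost surely equal ones.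
  have h2 : condDistrib (f ∘ Y) Z μ = condDistrib Y Z μ := by
    simp only [condDistrib, hjoint]
  rw [h2] at h1
  filter_upwards [ae_of_ae_map hZ.aemeasurable h1] with ω hω
  rw [← Kernel.map_apply _ hf, ← hω]

section component

variable {Ω A : Type*} [mΩ : MeasurableSpace Ω] [Nonempty A] [MeasurableSpace A]
  [StandardBorelSpace A] {μ : Measure Ω} {X : ℤ → Ω → A}

theorem measurable_ergodicComponent [IsFiniteMeasure μ] {s : Set (ℤ → A)}
    (hs : MeasurableSet s) :
    Measurable[invariantAlgebra X] fun ω => (ergodicComponent X μ ω).real s :=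
  (@Kernel.measurable_coe _ _ (invariantAlgebra X) _ _ s hs).ennreal_toReal

instance [IsFiniteMeasure μ] (ω : Ω) : IsProbabilityMeasure (ergodicComponent X μ ω) := by
  unfold ergodicComponent
  infer_instance

theorem ergodicComponent_ae_eq_condExp [IsFiniteMeasure μ] (hX : ∀ i, Measurable (X i))
    {s : Set (ℤ → A)} (hs : MeasurableSet s) :
    (fun ω => (ergodicComponent X μ ω).real s) =ᵐ[μ] μ⟦path X ⁻¹' s | invariantAlgebra X⟧ := by
  have h := @condDistrib_ae_eq_condExp Ω Ω (ℤ → A) _ _ _ mΩ μ _ id (path X)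
    (invariantAlgebra X) s (measurable_id'' (invariantAlgebra_le hX)) (measurable_path hX) hs
  rwa [MeasurableSpace.comap_id] at h

/-- The defining property of conditional expectation; it identifies the mean of the components over
an invariant cell with the law of the process conditioned on that cell. -/
theorem setIntegral_ergodicComponent [IsFiniteMeasure μ] (hX : ∀ i, Measurable (X i))
    {s : Set (ℤ → A)} (hs : MeasurableSet s) {F : Set Ω}
    (hF : MeasurableSet[invariantAlgebra X] F) :
    ∫ ω in F, (ergodicComponent X μ ω).real s ∂μ = μ.real (F ∩ path X ⁻¹' s) := by
  have hm := measurable_path hX hs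
  rw [setIntegral_congr_ae (g := μ⟦path X ⁻¹' s | invariantAlgebra X⟧)
    (invariantAlgebra_le hX _ hF) ((ergodicComponent_ae_eq_condExp hX hs).mono fun _ h _ => h),
    setIntegral_condExp (invariantAlgebra_le hX)
      ((integrable_const (1 : ℝ)).indicator hm) hF, integral_indicator hm,
    Measure.restrict_restrict hm]
  simp [Set.inter_comm]

theorem IsStationaryProcess.ae_ergodicComponent [IsFiniteMeasure μ]
    (h : IsStationaryProcess X μ) (hX : ∀ i, Measurable (X i)) :
    ∀ᵐ ω ∂μ, IsStationaryProcess coord (ergodicComponent X μ ω) := by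
  have hae := ae_map_condDistrib_eq (mβ := invariantAlgebra X) (μ := μ) (Z := id)
    (measurable_id'' (invariantAlgebra_le hX)) (measurable_path hX) measurable_shift
    fun F s hF hs => h.measure_inter_shift hX hF hs
  filter_upwards [hae] with ω hω
  have e : path (coord (A := A)) = id := rfl
  rw [IsStationaryProcess, e, Measure.map_id]
  exact hω

end component

/-! ### Quantizing a random distribution; Jensen's inequality. -/

section quantization

variable {Ω B : Type*} [Fintype B]

theorem measurable_entropy_comp [MeasurableSpace Ω] {q : Ω → B → ℝ}
    (hq : ∀ w, Measurable fun ω => q ω w) : Measurable fun ω => entropy (q ω) :=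
  continuous_entropy.measurable.comp (measurable_pi_lambda _ hq)

theorem integrable_entropy_comp [MeasurableSpace Ω] {μ : Measure Ω} [IsFiniteMeasure μ]
    {q : Ω → B → ℝ} (hq : ∀ w, Measurable fun ω => q ω w) (h0 : ∀ ω w, 0 ≤ q ω w)
    (h1 : ∀ ω w, q ω w ≤ 1) : Integrable (fun ω => entropy (q ω)) μ := by
  refine Integrable.of_bound (measurable_entropy_comp hq).aestronglyMeasurable
    (Fintype.card B / Real.log 2) (ae_of_all _ fun ω => ?_)
  rw [Real.norm_of_nonneg (entropy_nonneg (h0 ω) (h1 ω))]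
  exact entropy_le_card (h0 ω)

theorem integrable_of_mem_unitInterval [MeasurableSpace Ω] {μ : Measure Ω} [IsFiniteMeasure μ]
    {f : Ω → ℝ} (hf : Measurable f) (h0 : ∀ ω, 0 ≤ f ω) (h1 : ∀ ω, f ω ≤ 1) :
    Integrable f μ := by
  refine Integrable.of_bound hf.aestronglyMeasurable 1 (ae_of_all _ fun ω => ?_)
  rw [Real.norm_of_nonneg (h0 ω)]
  exact h1 ω

theorem setIntegral_div_mem_Icc [MeasurableSpace Ω] {μ : Measure Ω} [IsFiniteMeasure μ]
    {f : Ω → ℝ} (hf : Integrable f μ) {C : Set Ω} (hC : MeasurableSet C) (hμ : 0 < μ.real C)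
    {a b : ℝ} (hab : ∀ ω ∈ C, f ω ∈ Set.Icc a b) :
    (∫ ω in C, f ω ∂μ) / μ.real C ∈ Set.Icc a b := by
  have ha := setIntegral_mono_on (μ := μ) (integrable_const a).integrableOn hf.integrableOn hC
    fun ω hω => (hab ω hω).1
  have hb := setIntegral_mono_on (μ := μ) hf.integrableOn (integrable_const b).integrableOn hC
    fun ω hω => (hab ω hω).2
  rw [setIntegral_const, smul_eq_mul] at ha hb
  exact ⟨by rwa [le_div_iff₀ hμ, mul_comm], by rwa [div_le_iff₀ hμ, mul_comm]⟩

/-- A measurable family of sub-probability vectors is nearly constant on the cells of a finite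
partition, so that averaging it over a cell increases the mean entropy by at most `ε`. -/
theorem exists_finite_partition_entropy_le {m mΩ : MeasurableSpace Ω} (hm : m ≤ mΩ)
    {μ : Measure Ω} [IsFiniteMeasure μ] {q : Ω → B → ℝ}
    (hq : ∀ w, Measurable[m] fun ω => q ω w) (h0 : ∀ ω w, 0 ≤ q ω w) (h1 : ∀ ω w, q ω w ≤ 1)
    {ε : ℝ} (hε : 0 < ε) :
    ∃ (N : ℕ) (J : Ω → B → Fin N), Measurable[m] J ∧ ∀ j, 0 < μ.real (J ⁻¹' {j}) →
      μ.real (J ⁻¹' {j}) *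
          entropy (fun w => (∫ ω in J ⁻¹' {j}, q ω w ∂μ) / μ.real (J ⁻¹' {j})) ≤
        ∫ ω in J ⁻¹' {j}, entropy (q ω) ∂μ + ε * μ.real (J ⁻¹' {j}) := by
  have hq' : ∀ w, Measurable fun ω => q ω w := fun w => (hq w).mono hm le_rfl
  have huc : UniformContinuousOn (entropy : (B → ℝ) → ℝ) (Set.Icc 0 1) :=
    isCompact_Icc.uniformContinuousOn_of_continuous continuous_entropy.continuousOn
  obtain ⟨δ, hδ, hδε⟩ := Metric.uniformContinuousOn_iff.1 huc ε hε
  obtain ⟨n, hn⟩ := exists_nat_one_div_lt hδ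
  set M : ℕ := n + 1 with hM
  have hMpos : (0 : ℝ) < M := by positivity
  have hMδ : 1 / (M : ℝ) < δ := by rw [hM]; push_cast; exact hn
  -- Round each coordinate down to a multiple of 1/M. The value q = 1 requires M + 1 levels, and
  -- then the reduction modulo M + 1 in `Fin.ofNat` has no effect.
  refine ⟨M + 1, fun ω w => Fin.ofNat (M + 1) ⌊M * q ω w⌋₊, ?_, fun j hj => ?_⟩
  · refine @measurable_pi_lambda _ _ _ m _ _ fun w => ?_
    exact (measurable_from_nat (f := Fin.ofNat (M + 1))).comp
      (Nat.measurable_floor.comp ((hq w).const_mul (M : ℝ)))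
  set C := (fun ω w => Fin.ofNat (M + 1) ⌊M * q ω w⌋₊) ⁻¹' {j} with hCdef
  have hC : MeasurableSet C := by
    refine (measurable_pi_lambda _ fun w => ?_) (measurableSet_singleton j)
    exact (measurable_from_nat (f := Fin.ofNat (M + 1))).comp
      (Nat.measurable_floor.comp ((hq' w).const_mul (M : ℝ)))
  have hcell : ∀ ω ∈ C, ∀ w, q ω w ∈ Set.Icc ((j w : ℕ) / M : ℝ) (((j w : ℕ) + 1) / M) := by
    intro ω hω w
    have hjw : (j w : ℕ) = ⌊M * q ω w⌋₊ := by
      rw [← (congrFun hω w : _ = j w), Fin.val_ofNat]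
      refine Nat.mod_eq_of_lt (Nat.lt_succ_of_le (Nat.floor_le_of_le ?_))
      exact mul_le_of_le_one_right hMpos.le (h1 ω w)
    have hnn : 0 ≤ M * q ω w := mul_nonneg hMpos.le (h0 ω w)
    rw [hjw]
    exact ⟨by rw [div_le_iff₀ hMpos, mul_comm _ (M : ℝ)]; exact Nat.floor_le hnn,
      by rw [le_div_iff₀ hMpos, mul_comm _ (M : ℝ)]; exact (Nat.lt_floor_add_one _).le⟩
  set a : B → ℝ := fun w => (∫ ω in C, q ω w ∂μ) / μ.real C with ha
  have hint : ∀ w, Integrable (fun ω => q ω w) μ := fun w =>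
    integrable_of_mem_unitInterval (hq' w) (fun ω => h0 ω w) fun ω => h1 ω w
  have ha01 : ∀ w, a w ∈ Set.Icc (0 : ℝ) 1 := fun w =>
    setIntegral_div_mem_Icc (hint w) hC hj fun ω _ => ⟨h0 ω w, h1 ω w⟩
  -- Intervals are convex, so the average over a cell lies in the same box of side 1/M < δ as the
  -- vectors being averaged.
  have hacell : ∀ w, a w ∈ Set.Icc ((j w : ℕ) / M : ℝ) (((j w : ℕ) + 1) / M) := fun w =>
    setIntegral_div_mem_Icc (hint w) hC hj fun ω hω => hcell ω hω w
  have hclose : ∀ ω ∈ C, entropy a ≤ entropy (q ω) + ε := by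
    intro ω hω
    have hdist : dist a (q ω) < δ := by
      refine (dist_pi_lt_iff hδ).2 fun w => lt_of_le_of_lt ?_ hMδ
      refine (Real.dist_le_of_mem_Icc (hacell w) (hcell ω hω w)).trans_eq ?_
      rw [← sub_div, add_sub_cancel_left]
    have := hδε a ⟨fun w => (ha01 w).1, fun w => (ha01 w).2⟩ (q ω)
      ⟨fun w => h0 ω w, fun w => h1 ω w⟩ hdist
    rw [Real.dist_eq] at this
    linarith [(abs_lt.1 this).2]
  have hent := integrable_entropy_comp (μ := μ) hq' h0 h1
  have := setIntegral_mono_on (μ := μ) (integrable_const (entropy a)).integrableOn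
    (hent.add (integrable_const ε)).integrableOn hC hclose
  simp only [Pi.add_apply] at this
  rw [integral_add hent.integrableOn (integrable_const ε).integrableOn, setIntegral_const,
    setIntegral_const, smul_eq_mul, smul_eq_mul, mul_comm _ ε] at this
  exact this

theorem integral_entropy_le [MeasurableSpace Ω] {μ : Measure Ω} [IsProbabilityMeasure μ]
    {q : Ω → B → ℝ} (hq : ∀ w, Measurable fun ω => q ω w) (h0 : ∀ ω w, 0 ≤ q ω w)
    (h1 : ∀ ω w, q ω w ≤ 1) : ∫ ω, entropy (q ω) ∂μ ≤ entropy fun w => ∫ ω, q ω w ∂μ := by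
  have hint : ∀ w, Integrable (fun ω => q ω w) μ := fun w =>
    integrable_of_mem_unitInterval (hq w) (fun ω => h0 ω w) fun ω => h1 ω w
  have hneg : ∀ w, Integrable (fun ω => Real.negMulLog (q ω w)) μ := fun w =>
    integrable_of_mem_unitInterval (Real.continuous_negMulLog.measurable.comp (hq w))
      (fun ω => Real.negMulLog_nonneg (h0 ω w) (h1 ω w)) fun ω => negMulLog_le_one (h0 ω w)
  simp only [entropy_eq_sum_negMulLog]
  rw [integral_div, integral_finsetSum _ fun w _ => hneg w]
  refine div_le_div_of_nonneg_right (Finset.sum_le_sum fun w _ => ?_) log_two_pos.le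
  exact Real.concaveOn_negMulLog.le_map_integral Real.continuous_negMulLog.continuousOn
    isClosed_Ici (ae_of_all _ fun ω => h0 ω w) (hint w) (hneg w)

end quantization

/-! ### Conditioning on the cells of a finite partition. -/

theorem cond_real_mul_eq_inter {Ω : Type*} [MeasurableSpace Ω] {μ : Measure Ω}
    [IsFiniteMeasure μ] {F : Set Ω} (hF : MeasurableSet F) (s : Set Ω) :
    μ[|F].real s * μ.real F = μ.real (F ∩ s) := by
  simp only [measureReal_def, ← ENNReal.toReal_mul]
  rw [cond_mul_eq_inter hF]

theorem measurableSet_block_coord {A : Type*} [MeasurableSpace A]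
    [MeasurableSingletonClass A] (k : ℕ) (w : Fin k → A) :
    MeasurableSet (block (coord (A := A)) k ⁻¹' {w}) :=
  measurable_block measurable_coord k (measurableSet_singleton w)

theorem sum_setIntegral_preimage {Ω J : Type*} [MeasurableSpace Ω] {μ : Measure Ω}
    [Fintype J] [MeasurableSpace J] [MeasurableSingletonClass J] {f : Ω → J}
    (hf : Measurable f) {g : Ω → ℝ}
    (hg : Integrable g μ) : ∑ j, ∫ ω in f ⁻¹' {j}, g ω ∂μ = ∫ ω, g ω ∂μ := by
  rw [← integral_iUnion_fintype (fun j => hf (measurableSet_singleton j)) ?_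
    fun _ => hg.integrableOn]
  · rw [← Set.preimage_iUnion, Set.iUnion_of_singleton, Set.preimage_univ, setIntegral_univ]
  · intro i j hij
    exact Disjoint.preimage f (Set.disjoint_singleton.2 hij)

/-- The block entropy is at most the entropy of a finite partition plus the mean block entropy of
the process conditioned on its cells. -/
theorem blockEntropy_le_sum_cond {Ω A : Type*} [MeasurableSpace Ω] [Fintype A]
    [MeasurableSpace A] [MeasurableSingletonClass A] {μ : Measure Ω} [IsProbabilityMeasure μ]
    {X : ℤ → Ω → A} (hX : ∀ i, Measurable (X i)) {J : Type*} [Fintype J]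
    [MeasurableSpace J] [MeasurableSingletonClass J] {f : Ω → J} (hf : Measurable f) (n : ℕ) :
    blockEntropy X μ n ≤ entropy (fun j => μ.real (f ⁻¹' {j})) +
      ∑ j, μ.real (f ⁻¹' {j}) * blockEntropy X μ[|f ⁻¹' {j}] n := by
  have hmul : ∀ j (s : Set Ω),
      μ.real (f ⁻¹' {j}) * μ[|f ⁻¹' {j}].real s = μ.real (s ∩ f ⁻¹' {j}) := by
    intro j s
    rw [mul_comm, cond_real_mul_eq_inter (hf (measurableSet_singleton j)), Set.inter_comm]
  have hmix : blockEntropy X μ n = entropy fun w : Fin n → A =>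
      ∑ j, μ.real (f ⁻¹' {j}) * μ[|f ⁻¹' {j}].real (block X n ⁻¹' {w}) := by
    rw [blockEntropy]
    congr 1
    ext w
    simp only [hmul]
    exact (sum_measureReal_preimage hf _).symm
  rw [hmix]
  refine entropy_mixture_le (fun _ => measureReal_nonneg) (fun _ _ => measureReal_nonneg)
    fun j hj => ?_
  have hj' : μ (f ⁻¹' {j}) ≠ 0 := fun h0 => hj (by simp [measureReal_def, h0])
  have := cond_isProbabilityMeasure hj'
  exact sum_measureReal_block hX n

/-! ### Comparison of the conditional and unconditional rates. -/

section main

variable {Ω A : Type*} [MeasurableSpace Ω] [Fintype A] [Nonempty A] [MeasurableSpace A]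
  [MeasurableSingletonClass A] {μ : Measure Ω} [IsProbabilityMeasure μ] {X : ℤ → Ω → A}

theorem measurable_ergodicComponent_block (k : ℕ) (w : Fin k → A) :
    Measurable[invariantAlgebra X] fun ω =>
      (ergodicComponent X μ ω).real (block coord k ⁻¹' {w}) :=
  measurable_ergodicComponent (measurableSet_block_coord k w)

/-- Each conditional probability is determined only up to a null set; there are finitely many words,
so one null set serves for all. -/
theorem condBlockEntropy_eq_integral (hX : ∀ i, Measurable (X i)) (k : ℕ) :
    condBlockEntropy X μ (invariantAlgebra X) k =
      ∫ ω, blockEntropy coord (ergodicComponent X μ ω) k ∂μ := by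
  refine integral_congr_ae ?_
  have h : ∀ w : Fin k → A, ∀ᵐ ω ∂μ,
      (ergodicComponent X μ ω).real (block coord k ⁻¹' {w}) =
        (μ⟦block X k ⁻¹' {w} | invariantAlgebra X⟧) ω := fun w =>
    ergodicComponent_ae_eq_condExp hX (measurableSet_block_coord k w)
  filter_upwards [ae_all_iff.2 h] with ω hω
  simp only [blockEntropy, hω]

theorem condBlockEntropy_le (hX : ∀ i, Measurable (X i)) (k : ℕ) :
    condBlockEntropy X μ (invariantAlgebra X) k ≤ blockEntropy X μ k := by
  rw [condBlockEntropy_eq_integral hX]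
  refine (integral_entropy_le (fun w => (measurable_ergodicComponent_block k w).mono
    (invariantAlgebra_le hX) le_rfl) (fun _ _ => measureReal_nonneg)
    fun _ _ => measureReal_le_one).trans_eq ?_
  rw [blockEntropy]
  congr 1
  ext w
  have := setIntegral_ergodicComponent (μ := μ) hX (measurableSet_block_coord k w)
    (@MeasurableSet.univ _ (invariantAlgebra X))
  rw [setIntegral_univ, Set.univ_inter] at this
  exact this

theorem IsStationaryProcess.lim_le_condBlockEntropy_div (h : IsStationaryProcess X μ)
    (hX : ∀ i, Measurable (X i)) {k : ℕ} (hk : k ≠ 0) :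
    (h.subadditive_blockEntropy hX).lim ≤
      condBlockEntropy X μ (invariantAlgebra X) k / k := by
  classical
  set L := (h.subadditive_blockEntropy hX).lim
  have hkpos : (0 : ℝ) < k := by positivity
  rw [condBlockEntropy_eq_integral hX, le_div_iff₀ hkpos]
  refine le_of_forall_pos_le_add fun ε hε => ?_
  obtain ⟨N, J, hJ, hJε⟩ := exists_finite_partition_entropy_le (μ := μ) (invariantAlgebra_le hX)
    (fun w => measurable_ergodicComponent_block (μ := μ) k w) (fun _ _ => measureReal_nonneg)
    (fun _ _ => measureReal_le_one) hε
  have hJ' := hJ.mono (invariantAlgebra_le hX) le_rfl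
  have hcell : ∀ j, MeasurableSet[invariantAlgebra X] (J ⁻¹' {j}) := fun j =>
    hJ (measurableSet_singleton j)
  have hint : Integrable (fun ω => blockEntropy coord (ergodicComponent X μ ω) k) μ :=
    integrable_entropy_comp
      (fun w => (measurable_ergodicComponent_block (X := X) (μ := μ) k w).mono
      (invariantAlgebra_le hX) le_rfl)
    (fun _ _ => measureReal_nonneg) fun _ _ => measureReal_le_one
  set I := ∫ ω, blockEntropy coord (ergodicComponent X μ ω) k ∂μ
  have hterm : ∀ j, ∀ m : ℕ, μ.real (J ⁻¹' {j}) * blockEntropy X μ[|J ⁻¹' {j}] (m * k) ≤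
      m * (∫ ω in J ⁻¹' {j}, blockEntropy coord (ergodicComponent X μ ω) k ∂μ
        + ε * μ.real (J ⁻¹' {j})) := by
    intro j m
    -- On a null cell the conditioned measure is not a probability measure, but both sides vanish.
    rcases (measureReal_nonneg (μ := μ) (s := J ⁻¹' {j})).eq_or_lt with h0 | hpos
    · have hz : μ (J ⁻¹' {j}) = 0 := (measureReal_eq_zero_iff).1 h0.symm
      rw [← h0, Measure.restrict_eq_zero.2 hz]
      simp
    · have hj' : μ (J ⁻¹' {j}) ≠ 0 := fun h0 => hpos.ne' (by simp [measureReal_def, h0])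
      have := cond_isProbabilityMeasure hj'
      have hm := (h.cond hX (hcell j)).blockEntropy_mul_le hX m k
      have hdist : blockEntropy X μ[|J ⁻¹' {j}] k = entropy fun w : Fin k → A =>
          (∫ ω in J ⁻¹' {j}, (ergodicComponent X μ ω).real (block coord k ⁻¹' {w}) ∂μ) /
            μ.real (J ⁻¹' {j}) := by
        rw [blockEntropy]
        congr 1
        ext w
        rw [setIntegral_ergodicComponent hX (measurableSet_block_coord k w) (hcell j),
          eq_div_iff hpos.ne', cond_real_mul_eq_inter (hJ' (measurableSet_singleton j))]
        rfl
      calc _ ≤ μ.real (J ⁻¹' {j}) * (m * blockEntropy X μ[|J ⁻¹' {j}] k) :=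
            mul_le_mul_of_nonneg_left hm hpos.le
        _ = m * (μ.real (J ⁻¹' {j}) * blockEntropy X μ[|J ⁻¹' {j}] k) := by ring
        _ ≤ _ := mul_le_mul_of_nonneg_left (hdist ▸ hJε j hpos) m.cast_nonneg
  have hsum1 : ∑ j, μ.real (J ⁻¹' {j}) = 1 := by
    simpa using sum_measureReal_preimage (μ := μ) hJ' Set.univ
  set K := entropy fun j => μ.real (J ⁻¹' {j})
  -- The Fekete limit is an infimum, so L * (m * k) ≤ H(mk); then sum the bounds over the cells.
  have hbound : ∀ m : ℕ, m ≠ 0 → (m : ℝ) * (L * k) ≤ K + m * (I + ε) := by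
    intro m hm
    have hmk : (0 : ℝ) < (m * k : ℕ) := by positivity
    have h1 := (h.subadditive_blockEntropy hX).lim_le_div bddBelow_blockEntropy_div
      (n := m * k) (by positivity)
    rw [le_div_iff₀ hmk] at h1
    have h2 := blockEntropy_le_sum_cond (μ := μ) hX hJ' (m * k)
    have h3 := Finset.sum_le_sum fun j (_ : j ∈ Finset.univ) => hterm j m
    rw [← Finset.mul_sum, Finset.sum_add_distrib, ← Finset.mul_sum, hsum1, mul_one,
      sum_setIntegral_preimage hJ' hint] at h3
    calc (m : ℝ) * (L * k) = L * (m * k : ℕ) := by push_cast; ring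
      _ ≤ _ := h1.trans (h2.trans (by gcongr))
  by_contra! hlt
  -- If L * k exceeded I + ε, the gap times m would eventually outgrow K.
  obtain ⟨m, hm⟩ := exists_nat_gt (max 0 (K / (L * k - (I + ε))))
  have hmpos : (0 : ℝ) < m := (le_max_left _ _).trans_lt hm
  have hK := (le_max_right _ _).trans_lt hm
  rw [div_lt_iff₀ (by linarith)] at hK
  have := hbound m (by exact_mod_cast hmpos.ne')
  linarith

end main

/-- The entropy rate of a stationary process is the mean entropy rate of its ergodic components. -/
theorem IsStationaryProcess.entropyRate_ergodicDecomposition {Ω A : Type*} [MeasurableSpace Ω]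
    [Fintype A] [Nonempty A] [MeasurableSpace A] [MeasurableSingletonClass A]
    (μ : Measure Ω) [IsProbabilityMeasure μ] (X : ℤ → Ω → A)
    (hX : ∀ i, Measurable (X i)) (hstat : IsStationaryProcess X μ) :
    ∃ h : ℝ, HasEntropyRate X μ h ∧
      Tendsto (fun k : ℕ => condBlockEntropy X μ
        (invariantAlgebra X) k / k) atTop (𝓝 h) ∧
      ∃ r : Ω → ℝ,
        (∀ᵐ ω ∂μ, HasEntropyRate coord
          (ergodicComponent X μ ω) (r ω)) ∧
        Integrable r μ ∧ ∫ ω, r ω ∂μ = h := by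
  have hrate := hstat.hasEntropyRate hX
  have hcond : Tendsto (fun k : ℕ => condBlockEntropy X μ (invariantAlgebra X) k / k) atTop
      (𝓝 (hstat.subadditive_blockEntropy hX).lim) := by
    refine tendsto_of_tendsto_of_tendsto_of_le_of_le' tendsto_const_nhds hrate ?_ ?_
    · filter_upwards [eventually_ne_atTop 0] with k hk
      exact hstat.lim_le_condBlockEntropy_div hX hk
    · exact Eventually.of_forall fun k =>
        div_le_div_of_nonneg_right (condBlockEntropy_le hX k) k.cast_nonneg
  -- The rate is chosen pointwise, without regard to measurability; that is recovered below from its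
  -- being an almost everywhere limit of measurable functions.
  have hex : ∀ ω, ∃ r : ℝ, IsStationaryProcess coord (ergodicComponent X μ ω) →
      HasEntropyRate coord (ergodicComponent X μ ω) r := fun ω => by
    by_cases hs : IsStationaryProcess coord (ergodicComponent X μ ω)
    · exact ⟨_, fun _ => hs.hasEntropyRate measurable_coord⟩
    · exact ⟨0, fun h => absurd h hs⟩
  choose r hr using hex
  have hae := hstat.ae_ergodicComponent hX
  have hlim : ∀ᵐ ω ∂μ, HasEntropyRate coord (ergodicComponent X μ ω) (r ω) :=
    hae.mono hr
  have hmeas : ∀ k : ℕ, AEStronglyMeasurable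
      (fun ω => blockEntropy coord (ergodicComponent X μ ω) k / k) μ := fun k =>
    ((measurable_entropy_comp fun w => (measurable_ergodicComponent_block k w).mono
      (invariantAlgebra_le hX) le_rfl).div_const _).aestronglyMeasurable
  set c : ℝ := Fintype.card (Fin 1 → A) / Real.log 2
  have hbd : ∀ k : ℕ, ∀ᵐ ω ∂μ, ‖blockEntropy coord (ergodicComponent X μ ω) k / k‖ ≤ c :=
    fun k => hae.mono fun ω hs => by
      rw [Real.norm_of_nonneg (div_nonneg (blockEntropy_nonneg k) k.cast_nonneg)]
      exact hs.blockEntropy_div_le measurable_coord k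
  refine ⟨_, hrate, hcond, r, hlim, ?_, ?_⟩
  · refine Integrable.of_bound (aestronglyMeasurable_of_tendsto_ae atTop hmeas hlim) c ?_
    filter_upwards [hlim, ae_all_iff.2 hbd] with ω hω hb
    exact le_of_tendsto hω.norm (Eventually.of_forall hb)
  · have hdct := tendsto_integral_of_dominated_convergence (fun _ => c) hmeas
      (integrable_const c) hbd hlim
    refine tendsto_nhds_unique (hdct.congr fun k => ?_) hcond
    rw [integral_div, condBlockEntropy_eq_integral hX]

end StationaryProcess

theorem mainTheorem3 {Ω A : Type*} [MeasurableSpace Ω]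
    [Fintype A] [Nonempty A] [MeasurableSpace A] [MeasurableSingletonClass A]
    (μ : Measure Ω) [IsProbabilityMeasure μ] (X : ℤ → Ω → A)
    (hX : ∀ i, Measurable (X i)) (hstat : StationaryProcess.IsStationaryProcess X μ) :
    ∃ h : ℝ, StationaryProcess.HasEntropyRate X μ h ∧
      Tendsto (fun k : ℕ => StationaryProcess.condBlockEntropy X μ
        (StationaryProcess.invariantAlgebra X) k / k) atTop (𝓝 h) ∧
      ∃ r : Ω → ℝ,
        (∀ᵐ ω ∂μ, StationaryProcess.HasEntropyRate StationaryProcess.coord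
          (StationaryProcess.ergodicComponent X μ ω) (r ω)) ∧
        Integrable r μ ∧ ∫ ω, r ω ∂μ = h :=
  hstat.entropyRate_ergodicDecomposition μ X hX
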